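/- There is an absolute constant $C>0$ such that for every proximity parameter $\varepsilon>0$ there is an adaptive randomized tester for unateness of Boolean functions with the following properties. For every integer $n\ge 0$ (with $0\log 0=0$), given query access to an arbitrary $f:\{0,1\}^n\to\{0,1\}$, the tester always makes at most $C\,n\log(n)/\varepsilon$ queries to $f$, each of which may depend on the answers to the earlier ones; if $f$ is unate, the tester accepts with probability $1$; and if $f$ is $\varepsilon$-far from unate, the tester rejects with probability at least $0.9$. Here $f$ is unate if for every $i\in\{1,\dots,n\}$ it is monotone non-decreasing in the $i$-th coordinate or monotone non-increasing in the $i$-th coordinate, and $f$ is $\varepsilon$-far from unate if $2^{-n}\,|\{x\in\{0,1\}^n: f(x)\ne g(x)\}|\ge\varepsilon$ for every unate $g:\{0,1\}^n\to\{0,1\}$. -/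

import Mathlib

namespace UnatenessTesting

/-- The Boolean hypercube `{0,1}^n`, with `false = 0` and `true = 1`. -/
abbrev Cube (n : ℕ) : Type := Fin n → Bool

/-- Boolean functions on the `n`-dimensional hypercube. -/
abbrev BoolFun (n : ℕ) : Type := Cube n → Bool

/-- The two possible directions of monotonicity along a coordinate. -/
inductive Direction : Type
  | up : Direction
  | down : Direction

/-- The partial order on the hypercube given by directions `B`: in the `up` coordinates
`x i ≤ y i`, in the `down` coordinates `y i ≤ x i`. -/
def PrecB {n : ℕ} (B : Fin n → Direction) (x y : Cube n) : Prop :=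
  ∀ i, (B i = Direction.up → x i ≤ y i) ∧ (B i = Direction.down → y i ≤ x i)

/-- `f` is monotone with respect to the directions `B`. -/
def MonotoneWrt {n : ℕ} (B : Fin n → Direction) (f : BoolFun n) : Prop :=
  ∀ x y : Cube n, PrecB B x y → f x ≤ f y

/-- `f` is unate if it is monotone with respect to some directions. -/
def Unate {n : ℕ} (f : BoolFun n) : Prop :=
  ∃ B : Fin n → Direction, MonotoneWrt B f

/-- The fraction of points of the hypercube at which `f` and `g` differ. -/
noncomputable def distance {n : ℕ} (f g : BoolFun n) : ℝ :=
  ((Finset.univ.filter (fun x : Cube n => f x ≠ g x)).card : ℝ) / 2 ^ n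

/-- `f` is `ε`-far from the property `P`: its distance to each member of `P` is at least `ε`. -/
def IsFar {n : ℕ} (ε : ℝ) (f : BoolFun n) (P : Set (BoolFun n)) : Prop :=
  ∀ g ∈ P, ε ≤ distance f g

/-- A deterministic adaptive query algorithm with access to an unknown `f : {0,1}^n → {0,1}`,
as a decision tree: it stops and accepts (`true`) or rejects (`false`), or it queries `f` at a
point and continues in a way that depends on the answer. -/
inductive QueryTree (n : ℕ) : Type
  | output (accept : Bool) : QueryTree n
  | query (x : Cube n) (ifZero ifOne : QueryTree n) : QueryTree n

/-- The output of the algorithm on the function `f`; `true` means that it accepts. -/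
def QueryTree.run {n : ℕ} (f : BoolFun n) : QueryTree n → Bool
  | QueryTree.output b => b
  | QueryTree.query x t₀ t₁ => if f x = true then t₁.run f else t₀.run f

/-- The number of queries which the algorithm makes when it is run on the function `f`. -/
def QueryTree.numQueries {n : ℕ} (f : BoolFun n) : QueryTree n → ℕ
  | QueryTree.output _ => 0
  | QueryTree.query x t₀ t₁ =>
      (if f x = true then t₁.numQueries f else t₀.numQueries f) + 1

/-- A randomized adaptive tester: all the internal randomness is drawn first, and it selects a
deterministic adaptive query algorithm. -/
abbrev Tester (n : ℕ) : Type := PMF (QueryTree n)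

/-- The distribution of the output of the tester on `f`. -/
noncomputable def Tester.outcome {n : ℕ} (A : Tester n) (f : BoolFun n) : PMF Bool :=
  PMF.map (fun t : QueryTree n => t.run f) A

/-- The probability that the tester accepts `f`. -/
noncomputable def Tester.acceptProb {n : ℕ} (A : Tester n) (f : BoolFun n) : ℝ :=
  (Tester.outcome A f true).toReal

/-- The probability that the tester rejects `f`. -/
noncomputable def Tester.rejectProb {n : ℕ} (A : Tester n) (f : BoolFun n) : ℝ :=
  (Tester.outcome A f false).toReal

/-- On every input function and for every outcome of its internal randomness, the tester makes
at most `q` queries. -/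
def Tester.MakesAtMost {n : ℕ} (A : Tester n) (q : ℝ) : Prop :=
  ∀ t ∈ PMF.support A, ∀ f : BoolFun n, (t.numQueries f : ℝ) ≤ q

end UnatenessTesting

namespace UnatenessTesting

/-! Let `a i`, `b i` be the densities of increasing and decreasing edges in coordinate `i`. Sorting
`f` along each coordinate in its majority direction yields a unate function and costs at most `min
(a i) (b i)` per coordinate, so a function `ε`-far from unate has `∑ i, min (a i) (b i) ≥ ε`
(`le_sum_min_edgeDensity`).

The tester samples random edges until one is nonconstant, then stays in its coordinate until a
second nonconstant edge appears; two opposite types disprove unateness, so the error is one-sided.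
The second phase lasts `1 / (a i + b i)` steps on average, but coordinate `i` is entered with
probability proportional to `a i + b i`. These factors cancel, so no logarithm is lost: the expected
time `H` to rejection is at most `2 * n / ε` (`mul_acceptProb_edgeTester_le`). Running ten times as
long gives error at most 1/10 by Markov, with `O(n / ε)` queries, below the required bound when `n ≥
2`. -/

variable {n : ℕ}

/-! ### Sorting along coordinates -/

/-- The number of points `x` whose edge in the coordinate `i` is nonconstant for `f` and increases
towards the value `s` of the coordinate. -/
def edgeCount (f : BoolFun n) (i : Fin n) (s : Bool) : ℕ :=
  (Finset.univ.filter fun x : Cube n =>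
    f (Function.update x i (!s)) = false ∧ f (Function.update x i s) = true).card

/-- The fraction of the edges in the coordinate `i` which are nonconstant for `f` and increase
towards the value `s` of the coordinate. -/
noncomputable def edgeDensity (f : BoolFun n) (i : Fin n) (s : Bool) : ℝ :=
  (edgeCount f i s : ℝ) / 2 ^ n

/-- Sort `f` along the coordinate `i`, with the larger value where the coordinate is `s`. -/
def sortCoord (f : BoolFun n) (i : Fin n) (s : Bool) : BoolFun n := fun x =>
  if x i = s then f (Function.update x i (!s)) || f (Function.update x i s)
  else f (Function.update x i (!s)) && f (Function.update x i s)

theorem sortCoord_update_same (f : BoolFun n) (i : Fin n) (s : Bool) (x : Cube n) :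
    sortCoord f i s (Function.update x i s) =
      (f (Function.update x i (!s)) || f (Function.update x i s)) := by
  simp [sortCoord]

theorem sortCoord_update_not (f : BoolFun n) (i : Fin n) (s : Bool) (x : Cube n) :
    sortCoord f i s (Function.update x i (!s)) =
      (f (Function.update x i (!s)) && f (Function.update x i s)) := by
  simp [sortCoord]

/-- Sorting alters only the wrongly directed edges, at both ends; `edgeCount` also counts such an
edge once per end. -/
theorem card_sortCoord_ne_le (f : BoolFun n) (i : Fin n) (s : Bool) :
    (Finset.univ.filter fun x : Cube n => f x ≠ sortCoord f i s x).card ≤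
      edgeCount f i (!s) := by
  refine Finset.card_le_card fun x hx => ?_
  simp only [Finset.mem_filter, Finset.mem_univ, true_and, Bool.not_not] at hx ⊢
  by_cases h : x i = s
  · have hu : Function.update x i s = x := by rw [← h]; exact Function.update_eq_self i x
    simp only [sortCoord, h, if_true, hu] at hx ⊢
    revert hx
    cases f x <;> cases f (Function.update x i (!s)) <;> simp
  · have h' : x i = !s := by revert h; cases x i <;> cases s <;> simp
    have hu : Function.update x i (!s) = x := by rw [← h']; exact Function.update_eq_self i x
    simp only [sortCoord, h, if_false, hu] at hx ⊢
    revert hx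
    cases f x <;> cases f (Function.update x i s) <;> simp

theorem edgeCount_sortCoord_self (f : BoolFun n) (i : Fin n) (s : Bool) :
    edgeCount (sortCoord f i s) i (!s) = 0 := by
  rw [edgeCount, Finset.card_eq_zero, Finset.filter_eq_empty_iff]
  intro x _
  rw [Bool.not_not, sortCoord_update_same, sortCoord_update_not]
  cases f (Function.update x i (!s)) <;> cases f (Function.update x i s) <;> simp

/-- Summing over the cube is the same as summing over the pairs in the coordinate `i`. -/
theorem sum_update_add_sum_update (φ : Cube n → ℕ) (i : Fin n) (s : Bool) :
    ∑ x, (φ (Function.update x i (!s)) + φ (Function.update x i s)) = 2 * ∑ x, φ x := by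
  have hinv : Function.Involutive fun x : Cube n => Function.update x i (!(x i)) := by
    intro x
    simp
  have hflip : ∑ x, φ (Function.update x i (!(x i))) = ∑ x, φ x :=
    Equiv.sum_comp (hinv.toPerm _) φ
  have hpt : ∀ x : Cube n, φ (Function.update x i (!s)) + φ (Function.update x i s) =
      φ x + φ (Function.update x i (!(x i))) := by
    intro x
    by_cases h : x i = s
    · subst h
      rw [Function.update_eq_self, add_comm]
    · have h' : s = !(x i) := by revert h; cases x i <;> cases s <;> simp
      subst h'
      rw [Bool.not_not, Function.update_eq_self]
  rw [Finset.sum_congr rfl fun x _ => hpt x, Finset.sum_add_distrib, hflip, two_mul]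

/-- The claim splits over the two-dimensional faces in directions `i` and `j`, each a check of 16
cases. -/
theorem edgeCount_sortCoord_le (f : BoolFun n) {i j : Fin n} (hij : j ≠ i) (s t : Bool) :
    edgeCount (sortCoord f i s) j t ≤ edgeCount f j t := by
  have hsum : ∀ g : BoolFun n, edgeCount g j t = ∑ x : Cube n,
      if g (Function.update x j (!t)) = false ∧ g (Function.update x j t) = true
      then 1 else 0 := fun g => by rw [edgeCount, Finset.card_filter]
  -- The factor 2 appears because summing over pairs in coordinate `i` counts every point twice.
  refine Nat.le_of_mul_le_mul_left ?_ (Nat.succ_pos 1)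
  rw [hsum, hsum, ← sum_update_add_sum_update _ i s, ← sum_update_add_sum_update _ i s]
  refine Finset.sum_le_sum fun x _ => ?_
  simp only [Function.update_comm hij.symm, sortCoord_update_same, sortCoord_update_not]
  generalize f (Function.update (Function.update x j t) i s) = a
  generalize f (Function.update (Function.update x j t) i (!s)) = b
  generalize f (Function.update (Function.update x j (!t)) i s) = c
  generalize f (Function.update (Function.update x j (!t)) i (!s)) = d
  revert a b c d
  decide

theorem card_ne_triangle (f g h : BoolFun n) :
    (Finset.univ.filter fun x : Cube n => f x ≠ h x).card ≤
      (Finset.univ.filter fun x : Cube n => f x ≠ g x).card +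
        (Finset.univ.filter fun x : Cube n => g x ≠ h x).card := by
  refine (Finset.card_le_card fun x hx => ?_).trans (Finset.card_union_le _ _)
  simp only [Finset.mem_union, Finset.mem_filter, Finset.mem_univ, true_and] at hx ⊢
  by_contra! hc
  exact hx (hc.1.trans hc.2)

/-- The second conjunct keeps the induction going: each later sort is charged to the edge count of
the original `f`. -/
theorem exists_sorted (f : BoolFun n) (b : Fin n → Bool) (S : Finset (Fin n)) :
    ∃ g : BoolFun n, (∀ i ∈ S, edgeCount g i (!(b i)) = 0) ∧
      (∀ i, edgeCount g i (!(b i)) ≤ edgeCount f i (!(b i))) ∧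
      (Finset.univ.filter fun x : Cube n => f x ≠ g x).card ≤
        ∑ i ∈ S, edgeCount f i (!(b i)) := by
  induction S using Finset.induction_on with
  | empty => exact ⟨f, by simp, fun _ => le_rfl, by simp⟩
  | insert i S hi ih =>
    obtain ⟨g, hg0, hgle, hgd⟩ := ih
    have hle : ∀ j, edgeCount (sortCoord g i (b i)) j (!(b j)) ≤ edgeCount g j (!(b j)) := by
      intro j
      by_cases hj : j = i
      · subst hj
        simp [edgeCount_sortCoord_self]
      · exact edgeCount_sortCoord_le g hj _ _
    refine ⟨sortCoord g i (b i), fun j hj => ?_, fun j => (hle j).trans (hgle j), ?_⟩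
    · rcases Finset.mem_insert.1 hj with rfl | hj
      · exact edgeCount_sortCoord_self g j _
      · exact Nat.le_zero.1 ((hle j).trans (hg0 j hj).le)
    · rw [Finset.sum_insert hi, add_comm]
      exact (card_ne_triangle f g _).trans
        (add_le_add hgd ((card_sortCoord_ne_le g i (b i)).trans (hgle i)))

/-! ### Distance to unateness and edge densities -/

theorem not_edge_of_edgeCount_eq_zero {f : BoolFun n} {i : Fin n} {s : Bool}
    (h : edgeCount f i s = 0) (x : Cube n) :
    ¬ (f (Function.update x i (!s)) = false ∧ f (Function.update x i s) = true) := by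
  rw [edgeCount, Finset.card_eq_zero, Finset.filter_eq_empty_iff] at h
  exact h (Finset.mem_univ x)

/-- The directions in which the coordinate `i` increases towards `b i`. -/
def directions (b : Fin n → Bool) (i : Fin n) : Direction :=
  if b i = true then Direction.up else Direction.down

theorem monotoneWrt_of_edgeCount_eq_zero {g : BoolFun n} {b : Fin n → Bool}
    (h : ∀ i, edgeCount g i (!(b i)) = 0) : MonotoneWrt (directions b) g := by
  intro x y hxy
  -- Move from `x` to `y` one coordinate at a time; each genuine move follows an edge towards `b i`.
  have key : ∀ S : Finset (Fin n), g x ≤ g (S.piecewise y x) := by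
    intro S
    induction S using Finset.induction_on with
    | empty => simp
    | insert i S hi ih =>
      refine ih.trans ?_
      rw [Finset.piecewise_insert]
      set z := S.piecewise y x with hz
      have hzi : z i = x i := by simp [hz, hi]
      by_cases hyz : y i = x i
      · rw [hyz, ← hzi, Function.update_eq_self]
      · have hi' := hxy i
        have hy : y i = b i ∧ x i = !(b i) := by
          revert hi' hyz
          unfold directions
          cases b i <;> cases x i <;> cases y i <;> simp
        have he := not_edge_of_edgeCount_eq_zero (h i) z
        rw [Bool.not_not, ← hy.2, ← hzi, Function.update_eq_self, ← hy.1] at he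
        revert he
        cases g z <;> cases g (Function.update z i (y i)) <;> simp
  simpa using key Finset.univ

/-- The distance to unateness is at most the sum over the coordinates of the smaller of the two
densities of nonconstant edges. -/
theorem le_sum_min_edgeDensity {ε : ℝ} {f : BoolFun n} (hf : IsFar ε f {g | Unate g}) :
    ε ≤ ∑ i, min (edgeDensity f i true) (edgeDensity f i false) := by
  let b : Fin n → Bool := fun i => decide (edgeCount f i false ≤ edgeCount f i true)
  obtain ⟨g, hg0, -, hgd⟩ := exists_sorted f b Finset.univ
  have hu : Unate g :=
    ⟨directions b, monotoneWrt_of_edgeCount_eq_zero fun i => hg0 i (Finset.mem_univ i)⟩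
  refine (hf g hu).trans ?_
  have hmin : ∀ i, min (edgeDensity f i true) (edgeDensity f i false) =
      (edgeCount f i (!(b i)) : ℝ) / 2 ^ n := by
    intro i
    unfold edgeDensity
    rw [min_div_div_right (by positivity)]
    congr 1
    by_cases hi : edgeCount f i false ≤ edgeCount f i true
    · simp [b, hi]
    · simp [b, hi, (not_le.1 hi).le]
  rw [Finset.sum_congr rfl fun i _ => hmin i, ← Finset.sum_div, distance]
  gcongr
  exact_mod_cast hgd

/-! ### Parameters for which no function is far -/

theorem unate_const (c : Bool) : Unate (fun _ : Cube n => c) :=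
  ⟨fun _ => Direction.up, fun _ _ _ => le_rfl⟩

theorem distance_le_one (f g : BoolFun n) : distance f g ≤ 1 := by
  rw [distance, div_le_one (by positivity)]
  have h := Finset.card_filter_le (Finset.univ : Finset (Cube n)) fun x => f x ≠ g x
  rw [Finset.card_univ, Fintype.card_fun, Fintype.card_bool, Fintype.card_fin] at h
  exact_mod_cast h

theorem not_isFar_of_one_lt {ε : ℝ} (hε : 1 < ε) (f : BoolFun n) :
    ¬ IsFar ε f {g | Unate g} := fun h =>
  absurd ((h _ (unate_const false)).trans (distance_le_one f _)) (not_le.2 hε)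

/-- This case is needed because `n * log n = 0` here, so no query is allowed. -/
theorem not_isFar_of_le_one {ε : ℝ} (hε : 0 < ε) (hn : n ≤ 1) (f : BoolFun n) :
    ¬ IsFar ε f {g | Unate g} := by
  intro h
  have : Subsingleton (Fin n) := Fin.subsingleton_iff_le_one.2 hn
  refine absurd (le_sum_min_edgeDensity h) (not_le.2 (lt_of_le_of_lt ?_ hε))
  refine Finset.sum_nonpos fun i _ => ?_
  have hupd : ∀ (x : Cube n) (c : Bool), Function.update x i c = fun _ => c := by
    intro x c
    funext j
    rw [Subsingleton.elim j i, Function.update_self]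
  -- The only edge has at most one type, so one of the two densities vanishes.
  by_cases h1 : f (fun _ => true) = true
  · refine min_le_of_right_le (le_of_eq ?_)
    simp [edgeDensity, edgeCount, hupd, h1]
  · refine min_le_of_left_le (le_of_eq ?_)
    simp [edgeDensity, edgeCount, hupd, h1]

/-! ### Building testers and computing their acceptance probability -/

/-- The tester which queries `f` at `x` and continues with `A false` or `A true` according to the
answer. -/
noncomputable def Tester.query (x : Cube n) (A : Bool → Tester n) : Tester n :=
  (A false).bind fun t₀ => (A true).bind fun t₁ => PMF.pure (QueryTree.query x t₀ t₁)

theorem Tester.outcome_pure (t : QueryTree n) (f : BoolFun n) :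
    Tester.outcome (PMF.pure t) f = PMF.pure (t.run f) :=
  PMF.pure_map _ _

theorem Tester.outcome_bind {α : Type*} (p : PMF α) (k : α → Tester n) (f : BoolFun n) :
    Tester.outcome (p.bind k) f = p.bind fun a => Tester.outcome (k a) f :=
  PMF.map_bind _ _ _

/-- Both continuations are drawn in advance, but only the one for the answer `f x` is run; the other
draw integrates out. -/
theorem Tester.outcome_query (x : Cube n) (A : Bool → Tester n) (f : BoolFun n) :
    Tester.outcome (Tester.query x A) f = Tester.outcome (A (f x)) f := by
  simp only [Tester.query, Tester.outcome_bind, Tester.outcome_pure, QueryTree.run]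
  cases f x <;> simp [Tester.outcome, PMF.map, Function.comp_def]

theorem Tester.MakesAtMost.query {x : Cube n} {A : Bool → Tester n} {q : ℝ}
    (h : ∀ c, Tester.MakesAtMost (A c) q) : Tester.MakesAtMost (Tester.query x A) (q + 1) := by
  intro t ht f
  simp only [Tester.query, PMF.mem_support_bind_iff, PMF.mem_support_pure_iff] at ht
  obtain ⟨t₀, h₀, t₁, h₁, rfl⟩ := ht
  have e₀ := h false t₀ h₀ f
  have e₁ := h true t₁ h₁ f
  rw [QueryTree.numQueries]
  push_cast
  split_ifs <;> linarith

theorem Tester.MakesAtMost.bind {α : Type*} {p : PMF α} {k : α → Tester n} {q : ℝ}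
    (h : ∀ a, Tester.MakesAtMost (k a) q) : Tester.MakesAtMost (p.bind k) q := by
  intro t ht
  obtain ⟨a, -, ha⟩ := (PMF.mem_support_bind_iff _ _ _).1 ht
  exact h a t ha

theorem Tester.makesAtMost_output (c : Bool) {q : ℝ} (hq : 0 ≤ q) :
    Tester.MakesAtMost (PMF.pure (QueryTree.output c) : Tester n) q := by
  intro t ht f
  rw [PMF.mem_support_pure_iff] at ht
  subst ht
  simpa [QueryTree.numQueries] using hq

theorem Tester.acceptProb_output (c : Bool) (f : BoolFun n) :
    Tester.acceptProb (PMF.pure (QueryTree.output c)) f = if c = true then 1 else 0 := by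
  rw [Tester.acceptProb, Tester.outcome_pure, QueryTree.run, PMF.pure_apply]
  cases c <;> simp

theorem Tester.acceptProb_query (x : Cube n) (A : Bool → Tester n) (f : BoolFun n) :
    Tester.acceptProb (Tester.query x A) f = Tester.acceptProb (A (f x)) f := by
  rw [Tester.acceptProb, Tester.outcome_query, Tester.acceptProb]

theorem Tester.acceptProb_le_one (A : Tester n) (f : BoolFun n) :
    Tester.acceptProb A f ≤ 1 :=
  ENNReal.toReal_le_of_le_ofReal zero_le_one (by simpa using PMF.coe_le_one _ _)

theorem Tester.rejectProb_eq (A : Tester n) (f : BoolFun n) :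
    Tester.rejectProb A f = 1 - Tester.acceptProb A f := by
  have h := (Tester.outcome A f).tsum_coe
  rw [tsum_bool] at h
  have h' := congrArg ENNReal.toReal h
  rw [ENNReal.toReal_add (PMF.apply_ne_top _ _) (PMF.apply_ne_top _ _),
    ENNReal.toReal_one] at h'
  rw [Tester.rejectProb, Tester.acceptProb]
  linarith

theorem Tester.acceptProb_bind_uniform {α : Type*} [Fintype α] [Nonempty α] (k : α → Tester n)
    (f : BoolFun n) :
    Tester.acceptProb ((PMF.uniformOfFintype α).bind k) f =
      (∑ a, Tester.acceptProb (k a) f) / Fintype.card α := by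
  simp only [Tester.acceptProb, Tester.outcome_bind]
  rw [PMF.bind_apply, tsum_fintype, ENNReal.toReal_sum fun a _ =>
    ENNReal.mul_ne_top (PMF.apply_ne_top _ _) (PMF.apply_ne_top _ _), Finset.sum_div]
  refine Finset.sum_congr rfl fun a _ => ?_
  rw [PMF.uniformOfFintype_apply, ENNReal.toReal_mul, ENNReal.toReal_inv, ENNReal.toReal_natCast,
    div_eq_inv_mul]

/-! ### The edge tester and its one-sided error -/

/-- Query `f` at both ends of the edge at `x` in the coordinate `i`; continue with `A none` if the
edge is constant and with `A (some s)` if it increases towards the value `s` of the coordinate. -/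
noncomputable def edgeQuery (i : Fin n) (x : Cube n) (A : Option Bool → Tester n) : Tester n :=
  Tester.query (Function.update x i false) fun a =>
    Tester.query (Function.update x i true) fun b => A (if a = b then none else some b)

/-- The type of the edge at `x` in the coordinate `i`: `none` if it is constant, `some s` if it
increases towards the value `s` of the coordinate. -/
def edgeType (f : BoolFun n) (i : Fin n) (x : Cube n) : Option Bool :=
  if f (Function.update x i false) = f (Function.update x i true) then none
  else some (f (Function.update x i true))

theorem edgeType_eq_some_iff {f : BoolFun n} {i : Fin n} {x : Cube n} {s : Bool} :
    edgeType f i x = some s ↔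
      f (Function.update x i (!s)) = false ∧ f (Function.update x i s) = true := by
  unfold edgeType
  generalize hu : f (Function.update x i false) = a
  generalize hv : f (Function.update x i true) = b
  cases s <;> cases a <;> cases b <;> simp [hu, hv]

theorem acceptProb_edgeQuery (i : Fin n) (x : Cube n) (A : Option Bool → Tester n)
    (f : BoolFun n) :
    Tester.acceptProb (edgeQuery i x A) f = Tester.acceptProb (A (edgeType f i x)) f := by
  rw [edgeQuery, Tester.acceptProb_query, Tester.acceptProb_query, edgeType]

theorem makesAtMost_edgeQuery {i : Fin n} {x : Cube n} {A : Option Bool → Tester n} {q : ℝ}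
    (h : ∀ c, Tester.MakesAtMost (A c) q) : Tester.MakesAtMost (edgeQuery i x A) (q + 2) := by
  have h2 : q + 2 = q + 1 + 1 := by ring
  rw [h2]
  exact Tester.MakesAtMost.query fun a => Tester.MakesAtMost.query fun b => h _

/-- The tester running for `T` steps, each of which queries one random edge. In the state `none`
the coordinate of the edge is random, and finding a nonconstant edge of type `s` in the coordinate
`i` leads to the state `some (i, s)`. There the coordinate is fixed to `i` until the next
nonconstant edge is found; the tester rejects if that edge has the opposite type, and returns to
the state `none` otherwise. -/
noncomputable def edgeTester [NeZero n] : ℕ → Option (Fin n × Bool) → Tester n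
  | 0, _ => PMF.pure (QueryTree.output true)
  | T + 1, none => (PMF.uniformOfFintype (Fin n × Cube n)).bind fun p =>
      edgeQuery p.1 p.2 fun c => edgeTester T (c.map fun s => (p.1, s))
  | T + 1, some (i, s) => (PMF.uniformOfFintype (Cube n)).bind fun x =>
      edgeQuery i x fun c => match c with
        | none => edgeTester T (some (i, s))
        | some t => if t = s then edgeTester T none else PMF.pure (QueryTree.output false)

theorem makesAtMost_edgeTester [NeZero n] (T : ℕ) (st : Option (Fin n × Bool)) :
    Tester.MakesAtMost (edgeTester T st) (2 * T) := by
  induction T generalizing st with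
  | zero => exact Tester.makesAtMost_output _ (by simp)
  | succ T ih =>
    have hT : (2 * ((T + 1 : ℕ) : ℝ)) = 2 * T + 2 := by push_cast; ring
    rw [hT]
    rcases st with _ | ⟨i, s⟩
    · exact Tester.MakesAtMost.bind fun p => makesAtMost_edgeQuery fun c => ih _
    · refine Tester.MakesAtMost.bind fun x => makesAtMost_edgeQuery fun c => ?_
      rcases c with _ | t
      · exact ih _
      · dsimp only
        split_ifs
        · exact ih _
        · exact Tester.makesAtMost_output _ (by positivity)

theorem Unate.edgeType_ne {f : BoolFun n} (hf : Unate f) {i : Fin n} {s : Bool} {x y : Cube n}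
    (hx : edgeType f i x = some s) : edgeType f i y ≠ some (!s) := by
  obtain ⟨B, hB⟩ := hf
  intro hy
  rw [edgeType_eq_some_iff] at hx hy
  rw [Bool.not_not] at hy
  have hmono : ∀ (z : Cube n) (c d : Bool), ((B i = Direction.up → c ≤ d) ∧
      (B i = Direction.down → d ≤ c)) →
      f (Function.update z i c) ≤ f (Function.update z i d) := by
    intro z c d hcd
    refine hB _ _ fun j => ?_
    by_cases hj : j = i
    · subst hj
      simpa using hcd
    · simp [Function.update_of_ne hj]
  have h1 := hmono x s (!s)
  have h2 := hmono y (!s) s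
  rw [hx.1, hx.2] at h1
  rw [hy.1, hy.2] at h2
  revert h1 h2
  cases B i <;> cases s <;> simp

/-- The invariant `hst` says that the remembered type is witnessed by an actual edge, so a rejection
would exhibit two opposite edges. -/
theorem acceptProb_edgeTester_of_unate [NeZero n] {f : BoolFun n} (hf : Unate f) (T : ℕ)
    (st : Option (Fin n × Bool))
    (hst : ∀ i s, st = some (i, s) → ∃ x, edgeType f i x = some s) :
    Tester.acceptProb (edgeTester T st) f = 1 := by
  induction T generalizing st with
  | zero => simp [edgeTester, Tester.acceptProb_output]
  | succ T ih =>
    rcases st with _ | ⟨i, s⟩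
    · rw [edgeTester, Tester.acceptProb_bind_uniform,
        Finset.sum_congr rfl (g := fun _ => (1 : ℝ))]
      · rw [Finset.sum_const, Finset.card_univ, nsmul_one]
        exact div_self (Nat.cast_ne_zero.2 Fintype.card_ne_zero)
      · intro p _
        rw [acceptProb_edgeQuery]
        refine ih _ fun i s h => ?_
        obtain ⟨t, ht, h⟩ := Option.map_eq_some_iff.1 h
        obtain ⟨rfl, rfl⟩ := Prod.mk.inj h
        exact ⟨p.2, ht⟩
    · rw [edgeTester, Tester.acceptProb_bind_uniform,
        Finset.sum_congr rfl (g := fun _ => (1 : ℝ))]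
      · rw [Finset.sum_const, Finset.card_univ, nsmul_one]
        exact div_self (Nat.cast_ne_zero.2 Fintype.card_ne_zero)
      · intro x _
        rw [acceptProb_edgeQuery]
        obtain ⟨y, hy⟩ := hst i s rfl
        rcases hx : edgeType f i x with _ | t
        · exact ih _ hst
        · have hts : t = s := by
            by_contra hne
            refine hf.edgeType_ne hy (y := x) ?_
            rw [hx]
            revert hne
            cases t <;> cases s <;> simp
          simp only [hts, if_true]
          exact ih _ (by simp)

/-! ### Recurrences for acceptance and the expected time to rejection -/

theorem edgeDensity_nonneg (f : BoolFun n) (i : Fin n) (s : Bool) : 0 ≤ edgeDensity f i s := by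
  unfold edgeDensity
  positivity

/-- The sum over the edges in the coordinate `i` of a function of their type. -/
theorem sum_edgeType (f : BoolFun n) (i : Fin n) (G : Option Bool → ℝ) :
    ∑ x, G (edgeType f i x) = 2 ^ n * (edgeDensity f i true * G (some true) +
      edgeDensity f i false * G (some false) +
      (1 - (edgeDensity f i true + edgeDensity f i false)) * G none) := by
  have hpt : ∀ x, G (edgeType f i x) = G none +
      (if edgeType f i x = some true then 1 else 0) * (G (some true) - G none) +
      (if edgeType f i x = some false then 1 else 0) * (G (some false) - G none) := by
    intro x
    rcases edgeType f i x with _ | _ | _ <;> simp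
  have hcount : ∀ s, ∑ x, (if edgeType f i x = some s then (1 : ℝ) else 0) =
      2 ^ n * edgeDensity f i s := by
    intro s
    rw [edgeDensity, mul_div_cancel₀ _ (by positivity), edgeCount, Finset.sum_boole]
    simp only [edgeType_eq_some_iff]
  rw [Finset.sum_congr rfl fun x _ => hpt x, Finset.sum_add_distrib, Finset.sum_add_distrib,
    ← Finset.sum_mul, ← Finset.sum_mul, hcount, hcount, Finset.sum_const, Finset.card_univ]
  simp only [Fintype.card_fun, Fintype.card_bool, Fintype.card_fin, nsmul_eq_mul, Nat.cast_pow,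
    Nat.cast_ofNat]
  ring

theorem acceptProb_edgeTester_none [NeZero n] (T : ℕ) (f : BoolFun n) :
    Tester.acceptProb (edgeTester (T + 1) none) f =
      (∑ i, (edgeDensity f i true * Tester.acceptProb (edgeTester T (some (i, true))) f +
        edgeDensity f i false * Tester.acceptProb (edgeTester T (some (i, false))) f +
        (1 - (edgeDensity f i true + edgeDensity f i false)) *
          Tester.acceptProb (edgeTester T none) f)) / n := by
  rw [edgeTester, Tester.acceptProb_bind_uniform, Fintype.sum_prod_type]
  have h : ∀ i : Fin n, ∑ x : Cube n, Tester.acceptProb (edgeQuery i x fun c =>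
      edgeTester T (c.map fun s => (i, s))) f = _ := fun i =>
    (Finset.sum_congr rfl fun x _ => acceptProb_edgeQuery i x _ f).trans (sum_edgeType f i fun c =>
      Tester.acceptProb (edgeTester T (c.map fun s => (i, s))) f)
  rw [Finset.sum_congr rfl fun i _ => h i, ← Finset.mul_sum, Fintype.card_prod, Nat.cast_mul,
    mul_comm]
  simp only [Fintype.card_fun, Fintype.card_bool, Fintype.card_fin, Nat.cast_pow,
    Nat.cast_ofNat, Option.map_some, Option.map_none]
  exact mul_div_mul_right _ _ (by positivity)

theorem acceptProb_edgeTester_some [NeZero n] (T : ℕ) (f : BoolFun n) (i : Fin n) (s : Bool) :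
    Tester.acceptProb (edgeTester (T + 1) (some (i, s))) f =
      edgeDensity f i s * Tester.acceptProb (edgeTester T none) f +
        (1 - (edgeDensity f i true + edgeDensity f i false)) *
          Tester.acceptProb (edgeTester T (some (i, s))) f := by
  rw [edgeTester, Tester.acceptProb_bind_uniform]
  rw [Finset.sum_congr rfl fun x _ => acceptProb_edgeQuery i x _ f]
  refine (congrArg (· / _) (sum_edgeType f i fun c => Tester.acceptProb (match c with
    | none => edgeTester T (some (i, s))
    | some t => if t = s then edgeTester T none else PMF.pure (QueryTree.output false)) f)).trans ?_
  simp only [Fintype.card_fun, Fintype.card_bool, Fintype.card_fin, Nat.cast_pow,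
    Nat.cast_ofNat]
  rw [mul_div_cancel_left₀ _ (by positivity)]
  cases s <;> simp [Tester.acceptProb_output]

theorem edgeDensity_add_le_one (f : BoolFun n) (i : Fin n) :
    edgeDensity f i true + edgeDensity f i false ≤ 1 := by
  have h := sum_edgeType f i fun c => if c = none then 1 else 0
  have h0 : (0 : ℝ) ≤ ∑ x, if edgeType f i x = none then 1 else 0 :=
    Finset.sum_nonneg fun x _ => by split_ifs <;> norm_num
  rw [h] at h0
  have := nonneg_of_mul_nonneg_right h0 (by positivity)
  simp at this
  linarith

/-- An upper bound on the probability of accepting, by Markov's inequality for the number of steps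
before rejection, whose expectation is at most `2 * n / δ`. -/
theorem mul_acceptProb_edgeTester_le [NeZero n] {f : BoolFun n} {δ : ℝ} (hδ : 0 < δ)
    (hf : δ ≤ ∑ i, min (edgeDensity f i true) (edgeDensity f i false)) (T : ℕ) :
    (T * Tester.acceptProb (edgeTester T none) f ≤ 2 * n / δ) ∧
    ∀ i s, 0 < edgeDensity f i s →
      T * Tester.acceptProb (edgeTester T (some (i, s))) f ≤
        (1 + edgeDensity f i s * (2 * n / δ)) /
          (edgeDensity f i true + edgeDensity f i false) := by
  -- The bounds for the states `some (i, s)` solve `E = 1 + p * H + (1 - q) * E`, with `p` the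
  -- density of type `s` and `q` that of both types.
  have hn : (0 : ℝ) < n := Nat.cast_pos.2 (NeZero.pos n)
  set H : ℝ := 2 * n / δ with hH
  have hHpos : 0 < H := by positivity
  have hqpos : ∀ i s, 0 < edgeDensity f i s →
      0 < edgeDensity f i true + edgeDensity f i false := by
    intro i s hs
    have h1 := edgeDensity_nonneg f i true
    have h2 := edgeDensity_nonneg f i false
    cases s <;> linarith
  induction T with
  | zero =>
    refine ⟨by simpa using hHpos.le, fun i s hs => ?_⟩
    have := hqpos i s hs
    simp only [Nat.cast_zero, zero_mul]
    positivity
  | succ T ih =>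
    obtain ⟨ih0, ih1⟩ := ih
    constructor
    · have hle := Tester.acceptProb_le_one (edgeTester (T + 1) none) f
      have hstep : T * Tester.acceptProb (edgeTester (T + 1) none) f ≤ H - 1 := by
        rw [acceptProb_edgeTester_none, mul_div_assoc', div_le_iff₀ hn, Finset.mul_sum]
        have hpt : ∀ i : Fin n, (T : ℝ) *
            (edgeDensity f i true * Tester.acceptProb (edgeTester T (some (i, true))) f +
            edgeDensity f i false * Tester.acceptProb (edgeTester T (some (i, false))) f +
            (1 - (edgeDensity f i true + edgeDensity f i false)) *
              Tester.acceptProb (edgeTester T none) f) ≤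
            1 + H - H * min (edgeDensity f i true) (edgeDensity f i false) := by
          intro i
          have h1 := ih1 i true
          have h2 := ih1 i false
          have a0 := edgeDensity_nonneg f i true
          have b0 := edgeDensity_nonneg f i false
          have q1 := edgeDensity_add_le_one f i
          generalize edgeDensity f i true = a at *
          generalize edgeDensity f i false = b at *
          generalize Tester.acceptProb (edgeTester T (some (i, true))) f = u at *
          generalize Tester.acceptProb (edgeTester T (some (i, false))) f = v at *
          generalize Tester.acceptProb (edgeTester T none) f = w at *
          have hw := mul_le_mul_of_nonneg_left ih0 (sub_nonneg.2 q1)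
          -- The induction hypothesis needs `0 < a`; when `a = 0` the weight kills the term.
          have hu : a * (T * u) ≤ a * ((1 + a * H) / (a + b)) := by
            rcases a0.eq_or_lt with h | h
            · simp [← h]
            · exact mul_le_mul_of_nonneg_left (h1 h) a0
          have hv : b * (T * v) ≤ b * ((1 + b * H) / (a + b)) := by
            rcases b0.eq_or_lt with h | h
            · simp [← h]
            · exact mul_le_mul_of_nonneg_left (h2 h) b0
          have hmain : a * ((1 + a * H) / (a + b)) + b * ((1 + b * H) / (a + b)) +
              (1 - (a + b)) * H ≤ 1 + H - H * min a b := by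
            rcases (add_nonneg a0 b0).eq_or_lt with h | h
            · have ha : a = 0 := by linarith
              have hb : b = 0 := by linarith
              simp [ha, hb]
            -- The average chance that the second edge contradicts the first gives the gain `2 * a *
            -- b / (a + b)`, which is at least `min a b`.
            · have hmin : min a b * (a + b) ≤ 2 * (a * b) := by
                rcases le_total a b with hab | hab
                · rw [min_eq_left hab]
                  nlinarith
                · rw [min_eq_right hab]
                  nlinarith
              have hHm := mul_le_mul_of_nonneg_left hmin hHpos.le
              have he : a * ((1 + a * H) / (a + b)) + b * ((1 + b * H) / (a + b)) =
                  (a + b + (a ^ 2 + b ^ 2) * H) / (a + b) := by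
                ring
              have hd : (a + b + (a ^ 2 + b ^ 2) * H) / (a + b) ≤
                  1 + (a + b) * H - H * min a b := by
                rw [div_le_iff₀ h]
                nlinarith
              linarith
          linarith
        refine (Finset.sum_le_sum fun i _ => hpt i).trans ?_
        rw [Finset.sum_sub_distrib, ← Finset.mul_sum, Finset.sum_const, Finset.card_univ,
          Fintype.card_fin, nsmul_eq_mul]
        -- One `n` pays for the current step, the other for the summand 1 in `hpt`, the mean time
        -- spent in a fixed coordinate.
        have hHδ : H * δ = 2 * n := div_mul_cancel₀ _ hδ.ne'
        have := mul_le_mul_of_nonneg_left hf hHpos.le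
        linarith
      push_cast
      linarith
    · intro i s hs
      have hle := Tester.acceptProb_le_one (edgeTester (T + 1) (some (i, s))) f
      have hq := hqpos i s hs
      have hi := ih1 i s hs
      have q1 := edgeDensity_add_le_one f i
      have hcancel := div_mul_cancel₀ (1 + edgeDensity f i s * H) hq.ne'
      have h1 := mul_le_mul_of_nonneg_left hi (sub_nonneg.2 q1)
      have h2 := mul_le_mul_of_nonneg_left ih0 hs.le
      have hstep := congrArg ((T : ℝ) * ·) (acceptProb_edgeTester_some T f i s)
      push_cast
      linarith

theorem acceptProb_edgeTester_le [NeZero n] {ε : ℝ} (hε : 0 < ε) {f : BoolFun n}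
    (hf : IsFar ε f {g | Unate g}) {T : ℕ} (hT : 20 * n / ε ≤ T) :
    Tester.acceptProb (edgeTester T none) f ≤ 0.1 := by
  have hn : (0 : ℝ) < n := Nat.cast_pos.2 (NeZero.pos n)
  have h := (mul_acceptProb_edgeTester_le hε (le_sum_min_edgeDensity hf) T).1
  have hpos : (0 : ℝ) < T := lt_of_lt_of_le (by positivity) hT
  have he : 20 * (n : ℝ) / ε = 10 * (2 * n / ε) := by ring
  rw [he] at hT
  refine le_of_mul_le_mul_left (h.trans ?_) hpos
  linarith

/-! ### The final tester and its query bound -/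

/-- The tester with parameter `ε`, which is trivial when no function is `ε`-far from unate. -/
noncomputable def unatenessTester (ε : ℝ) (n : ℕ) : Tester n :=
  if h : 2 ≤ n ∧ ε ≤ 1 then
    haveI : NeZero n := ⟨by omega⟩
    edgeTester ⌈20 * n / ε⌉₊ none
  else PMF.pure (QueryTree.output true)

theorem makesAtMost_unatenessTester {ε : ℝ} (hε : 0 < ε) (n : ℕ) :
    Tester.MakesAtMost (unatenessTester ε n) (84 * (n * Real.log n / ε)) := by
  unfold unatenessTester
  split_ifs with h
  · have : NeZero n := ⟨by omega⟩
    intro t ht f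
    refine (makesAtMost_edgeTester _ _ t ht f).trans ?_
    -- Since `n / ε ≥ 1` absorbs the rounding, `2 * T ≤ 42 * n / ε`; then `log n ≥ 1 / 2` gives the
    -- constant 84.
    have hn : (2 : ℝ) ≤ n := by exact_mod_cast h.1
    have hlog : 1 / 2 ≤ Real.log n :=
      le_trans (by linarith [Real.log_two_gt_d9]) (Real.log_le_log two_pos hn)
    have hceil := (Nat.ceil_lt_add_one (a := 20 * (n : ℝ) / ε) (by positivity)).le
    have hone : 1 ≤ n / ε := by
      rw [le_div_iff₀ hε]
      linarith [h.2]
    have hmul := mul_le_mul_of_nonneg_left hlog (show (0 : ℝ) ≤ n / ε by positivity)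
    have e1 : 20 * (n : ℝ) / ε = 20 * (n / ε) := by ring
    have e2 : n * Real.log n / ε = n / ε * Real.log n := by ring
    rw [e1] at hceil
    rw [e1, e2]
    linarith
  · refine Tester.makesAtMost_output _ ?_
    have := Real.log_natCast_nonneg n
    positivity

theorem acceptProb_unatenessTester (ε : ℝ) {f : BoolFun n} (hf : Unate f) :
    Tester.acceptProb (unatenessTester ε n) f = 1 := by
  unfold unatenessTester
  split_ifs with h
  · have : NeZero n := ⟨by omega⟩
    exact acceptProb_edgeTester_of_unate hf _ _ (by simp)
  · simp [Tester.acceptProb_output]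

theorem le_rejectProb_unatenessTester {ε : ℝ} (hε : 0 < ε) {f : BoolFun n}
    (hf : IsFar ε f {g | Unate g}) :
    0.9 ≤ Tester.rejectProb (unatenessTester ε n) f := by
  unfold unatenessTester
  split_ifs with h
  · have : NeZero n := ⟨by omega⟩
    have := acceptProb_edgeTester_le hε hf (Nat.le_ceil _)
    rw [Tester.rejectProb_eq]
    norm_num at this ⊢
    linarith
  · rcases not_and_or.1 h with h | h
    · exact absurd hf (not_isFar_of_le_one hε (by omega) f)
    · exact absurd hf (not_isFar_of_one_lt (not_le.1 h) f)

end UnatenessTesting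

theorem theorem2 :
    ∃ C : ℝ, 0 < C ∧ ∀ ε : ℝ, 0 < ε →
      ∃ A : (n : ℕ) → UnatenessTesting.Tester n, ∀ n : ℕ,
        UnatenessTesting.Tester.MakesAtMost (A n) (C * ((n : ℝ) * Real.log (n : ℝ) / ε)) ∧
        (∀ f : UnatenessTesting.BoolFun n, UnatenessTesting.Unate f →
          UnatenessTesting.Tester.acceptProb (A n) f = 1) ∧
        (∀ f : UnatenessTesting.BoolFun n,
          UnatenessTesting.IsFar ε f {g | UnatenessTesting.Unate g} →
          (0.9 : ℝ) ≤ UnatenessTesting.Tester.rejectProb (A n) f) :=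
  ⟨84, by norm_num, fun ε hε => ⟨UnatenessTesting.unatenessTester ε, fun n =>
    ⟨UnatenessTesting.makesAtMost_unatenessTester hε n,
      fun _ hf => UnatenessTesting.acceptProb_unatenessTester ε hf,
      fun _ hf => UnatenessTesting.le_rejectProb_unatenessTester hε hf⟩⟩⟩
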